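/- Let $q$ be a prime power, let $e_1\ge e_2\ge 1$ be integers, put $d=e_1+e_2$, and let $V$ be a $d$-dimensional vector space over the field $\mathbb{F}_q$ with $q$ elements. For $i\in\{1,2\}$ let $X_i$ be the set of all $e_i$-dimensional subspaces of $V$ and let $Y_i\subseteq X_i$ be non-empty. Let $\alpha$ be a real number with $0<\alpha\le\min\{\alpha_1,\alpha_2\}$, where $\alpha_i=|Y_i|/|X_i|$. Then $$\frac{|\{(S_1,S_2)\in Y_1\times Y_2 : S_1\cap S_2=\{0\}\}|}{|Y_1|\cdot|Y_2|}\;\ge\;\left(1-\frac{3}{2}q^{-1}\right)\left(1-\left(\frac1\alpha-1\right)q^{-d/2}\right),$$ and the inequality is strict whenever $\left(\frac1\alpha-1\right)q^{-d/2}\ne 1$, that is, whenever the right-hand side is not $0$. -/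

import Mathlib

namespace ComplementaryPairs

/-- The set of all `e`-dimensional subspaces of the `F`-vector space `V`. -/
def subspacesOfDim (F V : Type*) [Field F] [AddCommGroup V] [Module F V] (e : ℕ) :
    Set (Submodule F V) :=
  {S | Module.finrank F S = e}

/-- The proportion `|Y| / |X|`, where `X` is the set of all `e`-subspaces of `V`. -/
noncomputable def density {F V : Type*} [Field F] [AddCommGroup V] [Module F V]
    (e : ℕ) (Y : Set (Submodule F V)) : ℝ :=
  (Y.ncard : ℝ) / ((subspacesOfDim F V e).ncard : ℝ)

/-- The proportion of pairs `(S₁, S₂) ∈ Y₁ × Y₂` with `S₁ ∩ S₂ = 0`. -/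
noncomputable def complementaryProportion {F V : Type*} [Field F] [AddCommGroup V] [Module F V]
    (Y₁ Y₂ : Set (Submodule F V)) : ℝ :=
  (({p : Submodule F V × Submodule F V | p.1 ∈ Y₁ ∧ p.2 ∈ Y₂ ∧ p.1 ⊓ p.2 = ⊥}.ncard : ℕ) : ℝ) /
    ((Y₁.ncard : ℝ) * (Y₂.ncard : ℝ))

end ComplementaryPairs

/-! Join `S` and `T` when they are complementary. This bipartite graph is regular of degree `Q = q ^
(e₁ * e₂)`, and both sides have the same size `G`, a Gaussian binomial coefficient. The core is a
spectral gap: on functions of sum zero the adjacency operator has norm at most `Q * q ^ (-d / 2)`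
(`sum_sq_complSum_le`). Cauchy–Schwarz then gives an expander mixing inequality
(`sq_card_compl_sub_le`), and the density bounds turn it into proportion `≥ (Q / G) * (1 - (1 / α -
1) * q ^ (-d / 2))`. Finally `Q / G > 1 - 3 / 2 * q⁻¹`, by an elementary estimate of the product of
the `1 - q ^ (-i)` (`mul_gaussBinom_lt`).

The gap is proved by induction on the codimension of `T` over the base `A`, without eigenspaces. For
a point `L ≤ T`, replacing `S` by `S ⊔ L` moves the problem to base `L`
(`complSum_eq_complSum_missSum`). Averaging over `L` leaves two quadratic forms, controlled by
operators between adjacent levels (`sum_sq_up_le`) and between a level and the points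
(`sum_sq_points_le`). Intervals above `A` replace the quotients `V ⧸ A`, so the ambient space never
changes. -/

namespace ComplementaryPairs

open Module Finset

/-! ### Arithmetic of `q`-numbers -/

/-- The `q`-analogue `1 + q + ⋯ + q ^ (n - 1)` of `n`. -/
noncomputable def qNum (q : ℝ) (n : ℕ) : ℝ := ∑ j ∈ range n, q ^ j

theorem qNum_zero (q : ℝ) : qNum q 0 = 0 := by simp [qNum]

theorem qNum_one (q : ℝ) : qNum q 1 = 1 := by simp [qNum]

theorem qNum_succ (q : ℝ) (n : ℕ) : qNum q (n + 1) = qNum q n + q ^ n := sum_range_succ _ _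

theorem qNum_succ' (q : ℝ) (n : ℕ) : qNum q (n + 1) = 1 + q * qNum q n := by
  simp only [qNum, sum_range_succ', pow_succ, mul_sum, pow_zero]
  rw [add_comm]
  congr 1
  exact sum_congr rfl fun _ _ => mul_comm _ _

theorem sub_one_mul_qNum (q : ℝ) (n : ℕ) : (q - 1) * qNum q n = q ^ n - 1 := by
  induction n with
  | zero => simp [qNum_zero]
  | succ n ih => rw [qNum_succ, mul_add, ih, pow_succ]; ring

theorem qNum_nonneg {q : ℝ} (hq : 0 ≤ q) (n : ℕ) : 0 ≤ qNum q n :=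
  sum_nonneg fun _ _ => pow_nonneg hq _

theorem qNum_succ_pos {q : ℝ} (hq : 0 ≤ q) (n : ℕ) : 0 < qNum q (n + 1) := by
  rw [qNum_succ']
  have := mul_nonneg hq (qNum_nonneg hq n)
  linarith

/-! ### Counting in intervals of the subspace lattice -/

section Finite

variable {F V : Type*} [Field F] [AddCommGroup V] [Module F V] [Finite V]

/-- The subspaces containing `A` in which `A` has codimension `k`. -/
noncomputable def Gr (A : Submodule F V) (k : ℕ) : Finset (Submodule F V) :=
  (Set.toFinite {S : Submodule F V | A ≤ S ∧ finrank F S = finrank F A + k}).toFinset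

theorem mem_Gr {A S : Submodule F V} {k : ℕ} :
    S ∈ Gr A k ↔ A ≤ S ∧ finrank F S = finrank F A + k := by
  simp [Gr]

theorem eq_of_le_of_finrank {S T : Submodule F V} (h : S ≤ T)
    (hd : finrank F T ≤ finrank F S) : S = T :=
  Submodule.eq_of_le_of_finrank_le h hd

theorem Gr_zero (A : Submodule F V) : Gr A 0 = {A} := by
  ext S
  rw [mem_Gr, mem_singleton]
  constructor
  · rintro ⟨h, hd⟩
    exact (eq_of_le_of_finrank h (by omega)).symm
  · rintro rfl
    simp

theorem inf_eq_of_not_le {A L S : Submodule F V} (hL : L ∈ Gr A 1) (hA : A ≤ S)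
    (h : ¬ L ≤ S) : S ⊓ L = A := by
  rw [mem_Gr] at hL
  symm
  apply eq_of_le_of_finrank (le_inf hA hL.1)
  have h1 : S ⊓ L < L := lt_of_le_of_ne inf_le_right fun e => h (inf_eq_right.mp e)
  have := Submodule.finrank_lt_finrank_of_lt h1
  omega

theorem finrank_sup_of_not_le {A L S : Submodule F V} (hL : L ∈ Gr A 1) (hA : A ≤ S)
    (h : ¬ L ≤ S) : finrank F (S ⊔ L : Submodule F V) = finrank F S + 1 := by
  have h1 := Submodule.finrank_sup_add_finrank_inf_eq S L
  rw [inf_eq_of_not_le hL hA h] at h1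
  rw [mem_Gr] at hL
  omega

theorem not_le_of_inf_eq {A L S T : Submodule F V} (hL : L ∈ Gr A 1) (hLT : L ≤ T)
    (h : S ⊓ T = A) : ¬ L ≤ S := by
  intro hLS
  rw [mem_Gr] at hL
  have := Submodule.finrank_mono (h ▸ le_inf hLS hLT : L ≤ A)
  omega

open Classical in
-- Flags `L ≤ T` are counted from either end. This passes from base `A` to base `L`, where the
-- codimension of `T` is one less.
theorem sum_sum_points_le {A : Submodule F V} {m : ℕ}
    (φ : Submodule F V → Submodule F V → ℝ) :
    ∑ T ∈ Gr A (m + 1), ∑ L ∈ Gr A 1 with L ≤ T, φ L T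
      = ∑ L ∈ Gr A 1, ∑ T ∈ Gr L m, φ L T := by
  apply sum_comm'
  intro T L
  simp only [mem_filter, mem_Gr]
  constructor
  · rintro ⟨⟨h1, h2⟩, ⟨h3, h4⟩, h5⟩
    exact ⟨⟨h5, by omega⟩, h3, h4⟩
  · rintro ⟨⟨h1, h2⟩, h3, h4⟩
    exact ⟨⟨h3.trans h1, by omega⟩, ⟨h3, h4⟩, h1⟩

theorem finrank_sup_self_lt {A S S' : Submodule F V} {k : ℕ} (hS : S ∈ Gr A k)
    (hS' : S' ∈ Gr A k) (h : S ≠ S') :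
    finrank F A + k < finrank F (S ⊔ S' : Submodule F V) := by
  rw [mem_Gr] at hS hS'
  by_contra! hle
  apply h
  have h1 := eq_of_le_of_finrank (le_sup_left : S ≤ S ⊔ S') (by omega)
  have h2 := eq_of_le_of_finrank (le_sup_right : S' ≤ S ⊔ S') (by omega)
  rw [h1, ← h2]

theorem one_lt_card_real (F : Type*) [Field F] [Fintype F] : 1 < (Fintype.card F : ℝ) := by
  exact_mod_cast Fintype.one_lt_card

variable [Fintype F]

open Classical in
/-- The number of points between `A` and `B`. -/
theorem card_points {A B : Submodule F V} {n : ℕ} (hAB : B ∈ Gr A n) :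
    (#{L ∈ Gr A 1 | L ≤ B} : ℝ) = qNum (Fintype.card F) n := by
  have := Fintype.ofFinite V
  rw [mem_Gr] at hAB
  have hcard (S : Submodule F V) : #{v : V | v ∈ S} = Fintype.card F ^ finrank F S := by
    rw [← Module.card_eq_pow_finrank (K := F) (V := S), Fintype.card_subtype]
  have hdiff {S : Submodule F V} (hS : A ≤ S) :
      (#{v : V | v ∈ S ∧ v ∉ A} : ℝ)
        = (Fintype.card F : ℝ) ^ finrank F S - (Fintype.card F : ℝ) ^ finrank F A := by
    have : ({v : V | v ∈ S ∧ v ∉ A} : Finset V)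
        = ({v : V | v ∈ S} : Finset V) \ ({v : V | v ∈ A} : Finset V) := by
      ext v; simp
    rw [this, cast_card_sdiff, hcard, hcard]
    · push_cast; rfl
    · intro v hv
      simp only [mem_filter, mem_univ, true_and] at hv ⊢
      exact hS hv
  have hmaps : ∀ v ∈ ({v : V | v ∈ B ∧ v ∉ A} : Finset V),
      A ⊔ Submodule.span F {v} ∈ ({L ∈ Gr A 1 | L ≤ B} : Finset _) := by
    intro v hv
    simp only [mem_filter, mem_univ, true_and] at hv
    rw [mem_filter, mem_Gr]
    refine ⟨⟨le_sup_left, ?_⟩, sup_le hAB.1 (by simpa using hv.1)⟩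
    have hlt : A < A ⊔ Submodule.span F {v} := by
      refine lt_of_le_of_ne le_sup_left fun e => hv.2 ?_
      rw [e]
      exact (le_sup_right : _ ≤ A ⊔ Submodule.span F {v}) (Submodule.mem_span_singleton_self v)
    have h1 := Submodule.finrank_lt_finrank_of_lt hlt
    have h2 := Submodule.finrank_add_le_finrank_add_finrank A (Submodule.span F {v})
    have h3 := finrank_span_singleton (K := F) (v := v) (by rintro rfl; exact hv.2 A.zero_mem)
    omega
  -- The vectors of `B` outside `A` are sorted by the point `A ⊔ span {v}`; the fibre over `L` is
  -- `L` minus `A`, of constant size.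
  have hkey := card_eq_sum_card_fiberwise hmaps
  have hfib : ∀ L ∈ ({L ∈ Gr A 1 | L ≤ B} : Finset _),
      (#{v ∈ ({v : V | v ∈ B ∧ v ∉ A} : Finset V) | A ⊔ Submodule.span F {v} = L} : ℝ)
        = (Fintype.card F : ℝ) ^ (finrank F A + 1) - (Fintype.card F : ℝ) ^ finrank F A := by
    intro L hL
    rw [mem_filter, mem_Gr] at hL
    rw [← hL.1.2, ← hdiff hL.1.1]
    congr 2
    ext v
    simp only [mem_filter, mem_univ, true_and]
    constructor
    · rintro ⟨⟨_, h2⟩, rfl⟩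
      exact ⟨(le_sup_right : _ ≤ A ⊔ Submodule.span F {v})
        (Submodule.mem_span_singleton_self v), h2⟩
    · rintro ⟨h1, h2⟩
      refine ⟨⟨hL.2 h1, h2⟩, ?_⟩
      apply eq_of_le_of_finrank (sup_le hL.1.1 (by simpa using h1))
      rw [hL.1.2]
      have := (mem_Gr.mp (mem_filter.mp (hmaps v (by simp [hL.2 h1, h2]))).1).2
      omega
  have hkey' := congrArg (Nat.cast : ℕ → ℝ) hkey
  rw [Nat.cast_sum, sum_congr rfl hfib, hdiff hAB.1, sum_const, nsmul_eq_mul, hAB.2] at hkey'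
  have hq := one_lt_card_real F
  have hs := sub_one_mul_qNum (Fintype.card F : ℝ) n
  set q : ℝ := ((Fintype.card F : ℕ) : ℝ)
  have hne : q ^ finrank F A * (q - 1) ≠ 0 :=
    mul_ne_zero (pow_ne_zero _ (by linarith)) (by linarith)
  apply mul_left_cancel₀ hne
  rw [pow_add] at hkey'
  rw [mul_assoc, mul_assoc, hs]
  linear_combination (-1) * hkey'

open Classical in
/-- The number of hyperplanes of `H` that contain `A`. -/
theorem card_hyperplanes (k : ℕ) {A H : Submodule F V} (hH : H ∈ Gr A (k + 1)) :
    (#{S ∈ Gr A k | S ≤ H} : ℝ) = qNum (Fintype.card F) (k + 1) := by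
  induction k generalizing A with
  | zero =>
    rw [Gr_zero, filter_true_of_mem]
    · simp [qNum_one]
    · simpa using (mem_Gr.mp hH).1
  | succ k ih =>
    have hq : (0 : ℝ) ≤ Fintype.card F := by positivity
    -- Double count of flags `L ≤ S ≤ H`: each `L` and each `S` lies in `qNum (k + 1)` of them, so
    -- there are as many hyperplanes as points.
    have h1 : ∑ L ∈ Gr A 1 with L ≤ H, ∑ S ∈ Gr L k with S ≤ H, (1 : ℝ)
        = ∑ S ∈ Gr A (k + 1) with S ≤ H, ∑ L ∈ Gr A 1 with L ≤ S, 1 := by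
      apply sum_comm'
      intro L S
      simp only [mem_filter, mem_Gr]
      constructor
      · rintro ⟨⟨⟨h1, h2⟩, h3⟩, ⟨h4, h5⟩, h6⟩
        exact ⟨⟨⟨h1, h2⟩, h4⟩, ⟨h1.trans h4, by omega⟩, h6⟩
      · rintro ⟨⟨⟨h1, h2⟩, h4⟩, ⟨h5, h6⟩, h7⟩
        exact ⟨⟨⟨h1, h2⟩, h4.trans h7⟩, ⟨h4, by omega⟩, h7⟩
    have h2 : ∀ L ∈ ({L ∈ Gr A 1 | L ≤ H} : Finset _),
        ∑ S ∈ Gr L k with S ≤ H, (1 : ℝ) = qNum (Fintype.card F) (k + 1) := by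
      intro L hL
      rw [mem_filter] at hL
      rw [← ih (A := L)]
      · simp
      · rw [mem_Gr] at hH hL ⊢
        exact ⟨hL.2, by omega⟩
    have h3 : ∀ S ∈ ({S ∈ Gr A (k + 1) | S ≤ H} : Finset _),
        ∑ L ∈ Gr A 1 with L ≤ S, (1 : ℝ) = qNum (Fintype.card F) (k + 1) := by
      intro S hS
      rw [← card_points (mem_filter.mp hS).1]
      simp
    rw [sum_congr rfl h2, sum_congr rfl h3, sum_const, sum_const, nsmul_eq_mul, nsmul_eq_mul,
      card_points hH] at h1
    exact (mul_right_cancel₀ (qNum_succ_pos hq k).ne' h1).symm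

open Classical in
/-- The number of `(k + 1)`-spaces above a `k`-space. -/
theorem card_covers {A S : Submodule F V} {k j : ℕ} (hS : S ∈ Gr A k)
    (hV : finrank F A + k + j = finrank F V) :
    (#{H ∈ Gr A (k + 1) | S ≤ H} : ℝ) = qNum (Fintype.card F) j := by
  rw [mem_Gr] at hS
  rw [← card_points (A := S) (B := ⊤) (n := j)]
  · congr 2
    ext H
    simp only [mem_filter, mem_Gr, le_top, and_true]
    constructor
    · rintro ⟨⟨h1, h2⟩, h3⟩
      exact ⟨h3, by omega⟩
    · rintro ⟨h1, h2⟩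
      exact ⟨⟨hS.1.trans h1, by omega⟩, h1⟩
  · rw [mem_Gr, finrank_top]
    exact ⟨le_top, by omega⟩

end Finite

/-! ### Quadratic forms of a relation, and Gaussian binomials -/

open Classical in
theorem sum_sq_sum_filter {α β : Type*} (s : Finset α) (t : Finset β) (r : α → β → Prop)
    (f : α → ℝ) :
    ∑ y ∈ t, (∑ x ∈ s with r x y, f x) ^ 2
      = ∑ x ∈ s, ∑ x' ∈ s, f x * f x' * (#{y ∈ t | r x y ∧ r x' y} : ℝ) := by
  simp_rw [sq, sum_filter, sum_mul_sum]
  rw [sum_comm]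
  refine sum_congr rfl fun x _ => ?_
  rw [sum_comm]
  refine sum_congr rfl fun x' _ => ?_
  rw [card_filter, Nat.cast_sum, mul_sum]
  refine sum_congr rfl fun y _ => ?_
  by_cases h : r x y <;> by_cases h' : r x' y <;> simp [h, h']

open Classical in
-- An operator and its transpose have the same norm. With `g` the image of `f`, `‖g‖²` is the inner
-- product of `f` with the transposed image of `g`; Cauchy–Schwarz and `hr` bound its square by `C *
-- ‖f‖² * ‖g‖²`, and one factor `‖g‖²` cancels.
theorem sum_sq_transpose_le {α β : Type*} (s : Finset α) (t : Finset β) (r : α → β → Prop)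
    {C : ℝ} (hC : 0 ≤ C)
    (hr : ∀ g : α → ℝ, ∑ x ∈ s, g x = 0 →
      ∑ y ∈ t, (∑ x ∈ s with r x y, g x) ^ 2 ≤ C * ∑ x ∈ s, g x ^ 2)
    (f : β → ℝ) (hf : ∑ x ∈ s, ∑ y ∈ t with r x y, f y = 0) :
    ∑ x ∈ s, (∑ y ∈ t with r x y, f y) ^ 2 ≤ C * ∑ y ∈ t, f y ^ 2 := by
  set g : α → ℝ := fun x => ∑ y ∈ t with r x y, f y with hg
  have h1 : ∑ x ∈ s, g x ^ 2 = ∑ y ∈ t, f y * ∑ x ∈ s with r x y, g x := by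
    have : ∀ x ∈ s, g x ^ 2 = ∑ y ∈ t, if r x y then f y * g x else 0 := by
      intro x _
      rw [sq]
      nth_rewrite 1 [hg]
      rw [sum_mul, sum_filter]
    rw [sum_congr rfl this, sum_comm]
    refine sum_congr rfl fun y _ => ?_
    rw [mul_sum, sum_filter]
  have h2 := sum_mul_sq_le_sq_mul_sq t f fun y => ∑ x ∈ s with r x y, g x
  rw [← h1] at h2
  have h3 := hr g hf
  have hX : 0 ≤ ∑ x ∈ s, g x ^ 2 := sum_nonneg fun _ _ => sq_nonneg _
  have hY : 0 ≤ ∑ y ∈ t, f y ^ 2 := sum_nonneg fun _ _ => sq_nonneg _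
  rcases hX.eq_or_lt with h0 | hpos
  · rw [← h0]
    exact mul_nonneg hC hY
  · have h4 := mul_le_mul_of_nonneg_left h3 hY
    have h5 : (∑ x ∈ s, g x ^ 2) * (∑ x ∈ s, g x ^ 2)
        ≤ (C * ∑ y ∈ t, f y ^ 2) * (∑ x ∈ s, g x ^ 2) := by
      nlinarith
    exact le_of_mul_le_mul_right h5 hpos

/-- The Gaussian binomial coefficient. -/
noncomputable def gaussBinom (q : ℝ) (n : ℕ) : ℕ → ℝ
  | 0 => 1
  | k + 1 => gaussBinom q n k * qNum q (n - k) / qNum q (k + 1)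

theorem gaussBinom_succ_mul {q : ℝ} (hq : 0 ≤ q) {n k j : ℕ} (h : n = k + j) :
    gaussBinom q n (k + 1) * qNum q (k + 1) = gaussBinom q n k * qNum q j := by
  subst h
  rw [gaussBinom, Nat.add_sub_cancel_left, div_mul_cancel₀ _ (qNum_succ_pos hq k).ne']

theorem gaussBinom_pos {q : ℝ} (hq : 0 ≤ q) {n k : ℕ} (h : k ≤ n) : 0 < gaussBinom q n k := by
  induction k with
  | zero => simp [gaussBinom]
  | succ k ih =>
    obtain ⟨j, rfl⟩ := Nat.exists_eq_add_of_le h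
    rw [gaussBinom, show k + 1 + j - k = j + 1 by omega]
    exact div_pos (mul_pos (ih (by omega)) (qNum_succ_pos hq j)) (qNum_succ_pos hq k)

/-! ### Operators between adjacent levels -/

section Finite

variable {F V : Type*} [Field F] [Fintype F] [AddCommGroup V] [Module F V] [Finite V]

open Classical in
theorem sum_sum_covers {A : Submodule F V} {k : ℕ} (f : Submodule F V → ℝ) :
    ∑ R ∈ Gr A k, ∑ S ∈ Gr A (k + 1) with R ≤ S, f S
      = qNum (Fintype.card F) (k + 1) * ∑ S ∈ Gr A (k + 1), f S := by
  simp_rw [sum_filter]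
  rw [sum_comm, mul_sum]
  refine sum_congr rfl fun S hS => ?_
  rw [← sum_filter, sum_const, nsmul_eq_mul, card_hyperplanes k hS]

open Classical in
theorem sum_sum_hyperplanes {A : Submodule F V} {k j : ℕ}
    (hV : finrank F A + k + j = finrank F V) (f : Submodule F V → ℝ) :
    ∑ H ∈ Gr A (k + 1), ∑ S ∈ Gr A k with S ≤ H, f S
      = qNum (Fintype.card F) j * ∑ S ∈ Gr A k, f S := by
  simp_rw [sum_filter]
  rw [sum_comm, mul_sum]
  refine sum_congr rfl fun S hS => ?_
  rw [← sum_filter, sum_const, nsmul_eq_mul, card_covers hS hV]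

theorem card_Gr {A : Submodule F V} (k : ℕ) {j : ℕ}
    (hV : finrank F A + k + j = finrank F V) :
    (#(Gr A k) : ℝ) = gaussBinom (Fintype.card F) (k + j) k := by
  classical
  induction k generalizing j with
  | zero => simp [Gr_zero, gaussBinom]
  | succ k ih =>
    have hq : (0 : ℝ) ≤ Fintype.card F := by positivity
    have h1 := ih (j := j + 1) (by omega)
    have h2 := sum_sum_hyperplanes (A := A) (k := k) (j := j + 1) (by omega) fun _ => 1
    have h3 : ∀ H ∈ Gr A (k + 1), ∑ S ∈ Gr A k with S ≤ H, (1 : ℝ)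
        = qNum (Fintype.card F) (k + 1) := by
      intro H hH
      rw [← card_hyperplanes k hH]
      simp
    rw [sum_congr rfl h3, sum_const, sum_const, nsmul_eq_mul, nsmul_eq_mul, mul_one, h1] at h2
    apply mul_right_cancel₀ (qNum_succ_pos hq k).ne'
    rw [h2, gaussBinom_succ_mul (j := j + 1) hq (by omega), show k + 1 + j = k + (j + 1) by omega,
      mul_comm]

open Classical in
-- Distinct `S`, `S'` have a common cover exactly when they have a common hyperplane, namely when `S
-- ⊔ S'` and `S ⊓ S'` have the right dimensions, and then each is unique. So the two counts differ
-- only on the diagonal.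
theorem card_common_covers {A S S' : Submodule F V} {k j : ℕ} (hS : S ∈ Gr A (k + 1))
    (hS' : S' ∈ Gr A (k + 1)) (hV : finrank F A + (k + 1) + j = finrank F V) :
    (#{H ∈ Gr A (k + 2) | S ≤ H ∧ S' ≤ H} : ℝ)
      = (#{R ∈ Gr A k | R ≤ S ∧ R ≤ S'} : ℝ)
        + if S = S' then qNum (Fintype.card F) j - qNum (Fintype.card F) (k + 1) else 0 := by
  by_cases h : S = S'
  · subst h
    simp only [and_self, if_true]
    rw [card_covers hS hV, card_hyperplanes k hS]
    ring
  · rw [if_neg h, add_zero]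
    have hlt := finrank_sup_self_lt hS hS' h
    have hdim := Submodule.finrank_sup_add_finrank_inf_eq S S'
    rw [mem_Gr] at hS hS'
    congr 1
    by_cases hd : finrank F (S ⊔ S' : Submodule F V) = finrank F A + (k + 2)
    · rw [card_eq_one.mpr ⟨S ⊔ S', ?_⟩, card_eq_one.mpr ⟨S ⊓ S', ?_⟩]
      · ext R
        simp only [mem_filter, mem_Gr, mem_singleton]
        constructor
        · rintro ⟨⟨_, h2⟩, h3, h4⟩
          exact eq_of_le_of_finrank (le_inf h3 h4) (by omega)
        · rintro rfl
          exact ⟨⟨le_inf hS.1 hS'.1, by omega⟩, inf_le_left, inf_le_right⟩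
      · ext H
        simp only [mem_filter, mem_Gr, mem_singleton]
        constructor
        · rintro ⟨⟨_, h2⟩, h3, h4⟩
          exact (eq_of_le_of_finrank (sup_le h3 h4) (by omega)).symm
        · rintro rfl
          exact ⟨⟨hS.1.trans le_sup_left, hd⟩, le_sup_left, le_sup_right⟩
    · rw [card_eq_zero.mpr, card_eq_zero.mpr]
      · rw [filter_eq_empty_iff]
        rintro R hR ⟨h3, h4⟩
        rw [mem_Gr] at hR
        have := Submodule.finrank_mono (le_inf h3 h4)
        omega
      · rw [filter_eq_empty_iff]
        rintro H hH ⟨h3, h4⟩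
        rw [mem_Gr] at hH
        have := Submodule.finrank_mono (sup_le h3 h4)
        omega

open Classical in
theorem sum_sq_up_eq {A : Submodule F V} {k j : ℕ}
    (hV : finrank F A + (k + 1) + j = finrank F V) (f : Submodule F V → ℝ) :
    ∑ H ∈ Gr A (k + 2), (∑ S ∈ Gr A (k + 1) with S ≤ H, f S) ^ 2
      = ∑ R ∈ Gr A k, (∑ S ∈ Gr A (k + 1) with R ≤ S, f S) ^ 2
        + (qNum (Fintype.card F) j - qNum (Fintype.card F) (k + 1))
          * ∑ S ∈ Gr A (k + 1), f S ^ 2 := by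
  rw [sum_sq_sum_filter, sum_sq_sum_filter (r := fun S R => R ≤ S), mul_sum, ← sum_add_distrib]
  refine sum_congr rfl fun S hS => ?_
  have : ∀ S' ∈ Gr A (k + 1), f S * f S' * (#{H ∈ Gr A (k + 2) | S ≤ H ∧ S' ≤ H} : ℝ)
      = f S * f S' * (#{R ∈ Gr A k | R ≤ S ∧ R ≤ S'} : ℝ)
        + if S = S' then
          f S * f S' * (qNum (Fintype.card F) j - qNum (Fintype.card F) (k + 1)) else 0 := by
    intro S' hS'
    rw [card_common_covers hS hS' hV, mul_add, mul_ite, mul_zero]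
  rw [sum_congr rfl this, sum_add_distrib, sum_ite_eq, if_pos hS]
  ring

open Classical in
theorem sum_sq_down_le_of_up {A : Submodule F V} {k : ℕ} {C : ℝ} (hC : 0 ≤ C)
    (hup : ∀ g : Submodule F V → ℝ, ∑ S ∈ Gr A k, g S = 0 →
      ∑ H ∈ Gr A (k + 1), (∑ S ∈ Gr A k with S ≤ H, g S) ^ 2 ≤ C * ∑ S ∈ Gr A k, g S ^ 2)
    (f : Submodule F V → ℝ) (hf : ∑ S ∈ Gr A (k + 1), f S = 0) :
    ∑ R ∈ Gr A k, (∑ S ∈ Gr A (k + 1) with R ≤ S, f S) ^ 2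
      ≤ C * ∑ S ∈ Gr A (k + 1), f S ^ 2 := by
  apply sum_sq_transpose_le _ _ (fun R S => R ≤ S) hC hup
  rw [sum_sum_covers, hf, mul_zero]

open Classical in
-- Induction on the level: `sum_sq_up_eq` trades the up form for the down form, and the latter is
-- the transpose of the up operator one level lower. The constants match since `q[k][j+1] + [j+1] -
-- [k+1] = q[k+1][j]`.
theorem sum_sq_up_le {A : Submodule F V} (k : ℕ) {j : ℕ}
    (hV : finrank F A + k + (j + 1) = finrank F V) (f : Submodule F V → ℝ)
    (hf : ∑ S ∈ Gr A k, f S = 0) :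
    ∑ H ∈ Gr A (k + 1), (∑ S ∈ Gr A k with S ≤ H, f S) ^ 2
      ≤ Fintype.card F * qNum (Fintype.card F) k * qNum (Fintype.card F) j
        * ∑ S ∈ Gr A k, f S ^ 2 := by
  have hq : (0 : ℝ) ≤ Fintype.card F := by positivity
  induction k generalizing j f with
  | zero =>
    rw [Gr_zero, sum_singleton] at hf
    rw [qNum_zero, mul_zero, zero_mul, zero_mul]
    apply le_of_eq
    refine sum_eq_zero fun H hH => ?_
    rw [Gr_zero, filter_singleton, if_pos (mem_Gr.mp hH).1, sum_singleton, hf]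
    simp
  | succ k ih =>
    rw [sum_sq_up_eq hV]
    have h1 := sum_sq_down_le_of_up (A := A) (k := k)
      (mul_nonneg (mul_nonneg hq (qNum_nonneg hq k)) (qNum_nonneg hq (j + 1)))
      (fun g hg => ih (j := j + 1) (by omega) g hg) f hf
    have h2 := qNum_succ' (Fintype.card F : ℝ) j
    have h3 := qNum_succ' (Fintype.card F : ℝ) k
    refine (add_le_add_left h1 _).trans (le_of_eq ?_)
    rw [h2, h3]
    ring

open Classical in
theorem sum_sq_down_le {A : Submodule F V} {k j : ℕ}
    (hV : finrank F A + k + (j + 1) = finrank F V) (f : Submodule F V → ℝ)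
    (hf : ∑ S ∈ Gr A (k + 1), f S = 0) :
    ∑ R ∈ Gr A k, (∑ S ∈ Gr A (k + 1) with R ≤ S, f S) ^ 2
      ≤ Fintype.card F * qNum (Fintype.card F) k * qNum (Fintype.card F) j
        * ∑ S ∈ Gr A (k + 1), f S ^ 2 := by
  have hq : (0 : ℝ) ≤ Fintype.card F := by positivity
  exact sum_sq_down_le_of_up
    (mul_nonneg (mul_nonneg hq (qNum_nonneg hq k)) (qNum_nonneg hq j))
    (fun g hg => sum_sq_up_le k hV g hg) f hf

open Classical in
theorem sum_down_above_point {A L : Submodule F V} {k : ℕ} (hL : L ∈ Gr A 1)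
    (f : Submodule F V → ℝ) :
    ∑ R ∈ Gr A (k + 1) with L ≤ R, ∑ S ∈ Gr A (k + 2) with R ≤ S, f S
      = qNum (Fintype.card F) (k + 1) * ∑ S ∈ Gr A (k + 2) with L ≤ S, f S := by
  have hGr (i : ℕ) : ({R ∈ Gr A (i + 1) | L ≤ R} : Finset _) = Gr L i := by
    rw [mem_Gr] at hL
    ext R
    simp only [mem_filter, mem_Gr]
    constructor
    · rintro ⟨⟨h1, h2⟩, h3⟩
      exact ⟨h3, by omega⟩
    · rintro ⟨h1, h2⟩
      exact ⟨⟨hL.1.trans h1, by omega⟩, h1⟩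
  rw [hGr, hGr, ← sum_sum_covers]
  refine sum_congr rfl fun R hR => sum_congr ?_ fun _ _ => rfl
  rw [← hGr, filter_filter]
  refine filter_congr fun S _ => ?_
  rw [mem_Gr] at hR
  exact ⟨fun h => ⟨hR.1.trans h, h⟩, fun h => h.2⟩

open Classical in
-- The descent to points goes one level at a time: `sum_down_above_point` compares point sums of
-- consecutive levels, each step costs the constant of `sum_sq_down_le`, and the product of these
-- constants assembles into a Gaussian binomial.
theorem sum_sq_points_le {A : Submodule F V} (k : ℕ) {j : ℕ}
    (hV : finrank F A + (k + 1) + j = finrank F V) (f : Submodule F V → ℝ)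
    (hf : ∑ S ∈ Gr A (k + 1), f S = 0) :
    qNum (Fintype.card F) (k + j) * ∑ L ∈ Gr A 1, (∑ S ∈ Gr A (k + 1) with L ≤ S, f S) ^ 2
      ≤ qNum (Fintype.card F) (k + 1) * (Fintype.card F : ℝ) ^ k
        * gaussBinom (Fintype.card F) (k + j) (k + 1) * ∑ S ∈ Gr A (k + 1), f S ^ 2 := by
  have hq : (0 : ℝ) ≤ Fintype.card F := by positivity
  induction k generalizing j f with
  | zero =>
    apply le_of_eq
    rw [gaussBinom, gaussBinom]
    simp only [zero_add, qNum_one, pow_zero, one_mul, Nat.sub_zero, div_one]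
    congr 1
    refine sum_congr rfl fun L hL => ?_
    have : ({S ∈ Gr A 1 | L ≤ S} : Finset _) = {L} := by
      ext S
      rw [mem_Gr] at hL
      simp only [mem_filter, mem_Gr, mem_singleton]
      constructor
      · rintro ⟨⟨_, h2⟩, h3⟩
        exact (eq_of_le_of_finrank h3 (by omega)).symm
      · rintro rfl
        exact ⟨hL, le_rfl⟩
    rw [this, sum_singleton]
  | succ k ih =>
    have h1 := ih (j := j + 1) (by omega) (fun R => ∑ S ∈ Gr A (k + 2) with R ≤ S, f S)
      (by rw [sum_sum_covers, hf, mul_zero])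
    rw [sum_congr rfl fun L hL => by rw [sum_down_above_point hL, mul_pow], ← mul_sum] at h1
    have h2 := sum_sq_down_le (k := k + 1) (j := j) (by omega) f hf
    have h3 := gaussBinom_succ_mul hq (show k + (j + 1) = k + 1 + j by omega)
    have hk := qNum_succ_pos hq k
    rw [show k + 1 + j = k + (j + 1) by omega] at *
    set q : ℝ := ((Fintype.card F : ℕ) : ℝ)
    have hg : 0 ≤ gaussBinom q (k + (j + 1)) (k + 1) := (gaussBinom_pos hq (by omega)).le
    have h4 := h1.trans (mul_le_mul_of_nonneg_left h2
      (mul_nonneg (mul_nonneg hk.le (pow_nonneg hq k)) hg))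
    refine le_of_mul_le_mul_left ?_ (pow_pos hk 2)
    calc _ = _ := by ring
      _ ≤ _ := h4
      _ = qNum q (k + 1) ^ 2 * (q ^ (k + 1)
          * (gaussBinom q (k + (j + 1)) (k + 1) * qNum q j)
          * ∑ S ∈ Gr A (k + 1 + 1), f S ^ 2) := by ring
      _ = _ := by rw [← h3]; ring

end Finite

/-! ### Sums over complements, and reduction through a point -/

section Finite

variable {F V : Type*} [Field F] [AddCommGroup V] [Module F V] [Finite V]

open Classical in
/-- The sum of `f` over the `k`-spaces above `A` that meet `T` in `A` only. -/
noncomputable def complSum (A : Submodule F V) (k : ℕ) (f : Submodule F V → ℝ)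
    (T : Submodule F V) : ℝ :=
  ∑ S ∈ Gr A k with S ⊓ T = A, f S

open Classical in
/-- The sum of `f` over the `k`-spaces above `A` that lie in `H` and miss `L`. -/
noncomputable def missSum (A : Submodule F V) (k : ℕ) (f : Submodule F V → ℝ)
    (L H : Submodule F V) : ℝ :=
  ∑ S ∈ Gr A k with S ≤ H ∧ ¬ L ≤ S, f S

/-- If `S` misses `L`, then `S ⊔ L` is the only candidate for `H`; this is the reindexing behind the
sums of `missSum`. -/
theorem sup_mem_Gr_and_iff {A L S H : Submodule F V} {k : ℕ} (hL : L ∈ Gr A 1) :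
    (H ∈ Gr L k ∧ S ∈ Gr A k ∧ S ≤ H ∧ ¬ L ≤ S) ↔ (S ∈ Gr A k ∧ ¬ L ≤ S) ∧ H = S ⊔ L := by
  constructor
  · rintro ⟨hH, hS, hSH, hLS⟩
    refine ⟨⟨hS, hLS⟩, ?_⟩
    rw [mem_Gr] at hH
    have h1 := finrank_sup_of_not_le hL (mem_Gr.mp hS).1 hLS
    rw [mem_Gr] at hL hS
    exact (eq_of_le_of_finrank (sup_le hSH hH.1) (by omega)).symm
  · rintro ⟨⟨hS, hLS⟩, rfl⟩
    refine ⟨?_, hS, le_sup_left, hLS⟩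
    have h1 := finrank_sup_of_not_le hL (mem_Gr.mp hS).1 hLS
    rw [mem_Gr] at hL hS ⊢
    exact ⟨le_sup_right, by omega⟩

theorem sup_inf_eq_of_inf_eq {A L S T : Submodule F V} (hL : L ∈ Gr A 1) (hLT : L ≤ T)
    (h : S ⊓ T = A) : (S ⊔ L) ⊓ T = L := by
  rw [mem_Gr] at hL
  rw [sup_comm, sup_inf_assoc_of_le S hLT, h, sup_eq_left]
  exact hL.1

theorem inf_eq_of_sup_inf_eq {A L S T : Submodule F V} (hL : L ∈ Gr A 1) (hLT : L ≤ T)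
    (hA : A ≤ S) (hLS : ¬ L ≤ S) (h : (S ⊔ L) ⊓ T = L) : S ⊓ T = A := by
  rw [← inf_eq_of_not_le hL hA hLS]
  apply le_antisymm
  · exact le_inf inf_le_left ((inf_le_inf_right T le_sup_left).trans h.le)
  · exact inf_le_inf_left S hLT

/-- By the modular law, for `L ≤ T`, `S ⊓ T = A` holds iff `S` misses `L` and `(S ⊔ L) ⊓ T = L`.
Grouping the `S` by `S ⊔ L` gives the reduction. -/
theorem complSum_eq_complSum_missSum {A L T : Submodule F V} {k : ℕ} (hL : L ∈ Gr A 1)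
    (hLT : L ≤ T) (f : Submodule F V → ℝ) :
    complSum A k f T = complSum L k (missSum A k f L) T := by
  classical
  unfold complSum missSum
  rw [sum_comm' (t' := {S ∈ Gr A k | S ⊓ T = A}) (s' := fun S => {S ⊔ L})]
  · simp
  · intro H S
    rw [mem_filter, mem_filter, mem_filter, mem_singleton, and_right_comm,
      sup_mem_Gr_and_iff hL]
    constructor
    · rintro ⟨⟨⟨hS, hLS⟩, rfl⟩, h⟩
      exact ⟨rfl, hS, inf_eq_of_sup_inf_eq hL hLT (mem_Gr.mp hS).1 hLS h⟩
    · rintro ⟨rfl, hS, h⟩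
      exact ⟨⟨⟨hS, not_le_of_inf_eq hL hLT h⟩, rfl⟩, sup_inf_eq_of_inf_eq hL hLT h⟩

open Classical in
theorem sum_missSum {A L : Submodule F V} {k : ℕ} (hL : L ∈ Gr A 1) (f : Submodule F V → ℝ) :
    ∑ H ∈ Gr L k, missSum A k f L H = ∑ S ∈ Gr A k with ¬ L ≤ S, f S := by
  unfold missSum
  rw [sum_comm' (t' := {S ∈ Gr A k | ¬ L ≤ S}) (s' := fun S => {S ⊔ L})]
  · simp
  · intro H S
    rw [mem_filter, mem_filter, mem_singleton, sup_mem_Gr_and_iff hL, and_comm]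

open Classical in
theorem missSum_eq_sub (A : Submodule F V) (k : ℕ) (f : Submodule F V → ℝ)
    (L H : Submodule F V) :
    missSum A k f L H
      = ∑ S ∈ Gr A k with S ≤ H, f S - ∑ S ∈ {S ∈ Gr A k | S ≤ H} with L ≤ S, f S := by
  rw [missSum, ← sum_filter_add_sum_filter_not {S ∈ Gr A k | S ≤ H} (fun S => L ≤ S),
    filter_filter, filter_filter]
  ring

variable [Fintype F]

open Classical in
theorem card_points_inf {A H S S' : Submodule F V} {k : ℕ} (hH : H ∈ Gr A (k + 2))
    (hS : S ∈ Gr A (k + 1)) (hS' : S' ∈ Gr A (k + 1)) (hSH : S ≤ H) (hSH' : S' ≤ H) :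
    (#{L ∈ {L ∈ Gr A 1 | L ≤ H} | L ≤ S ∧ L ≤ S'} : ℝ)
      = qNum (Fintype.card F) k + if S = S' then (Fintype.card F : ℝ) ^ k else 0 := by
  have h1 : ({L ∈ {L ∈ Gr A 1 | L ≤ H} | L ≤ S ∧ L ≤ S'} : Finset _)
      = {L ∈ Gr A 1 | L ≤ S ⊓ S'} := by
    rw [filter_filter]
    refine filter_congr fun L _ => ?_
    rw [le_inf_iff]
    exact ⟨fun h => h.2, fun h => ⟨h.1.trans hSH, h⟩⟩
  rw [h1]
  by_cases h : S = S'
  · subst h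
    rw [if_pos rfl, inf_idem, card_points hS, qNum_succ]
  · rw [if_neg h, add_zero, card_points]
    have h2 := finrank_sup_self_lt hS hS' h
    have h3 := Submodule.finrank_sup_add_finrank_inf_eq S S'
    have h4 := Submodule.finrank_mono (sup_le hSH hSH')
    rw [mem_Gr] at *
    exact ⟨le_inf hS.1 hS'.1, by omega⟩

open Classical in
-- Points and hyperplanes of `H` form a design: two distinct hyperplanes share `qNum k` points, so
-- every term is a multiple of the sum of squares or of the squared sum.
theorem sum_sq_missSum {A H : Submodule F V} {k : ℕ} (hH : H ∈ Gr A (k + 2))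
    (f : Submodule F V → ℝ) :
    ∑ L ∈ Gr A 1 with L ≤ H, missSum A (k + 1) f L H ^ 2
      = (Fintype.card F : ℝ) ^ k * ∑ S ∈ Gr A (k + 1) with S ≤ H, f S ^ 2
        + ((Fintype.card F : ℝ) ^ (k + 1) - (Fintype.card F : ℝ) ^ k)
          * (∑ S ∈ Gr A (k + 1) with S ≤ H, f S) ^ 2 := by
  simp_rw [missSum_eq_sub, sub_sq, sum_add_distrib, sum_sub_distrib]
  set s : Finset (Submodule F V) := {S ∈ Gr A (k + 1) | S ≤ H} with hs
  set t : Finset (Submodule F V) := {L ∈ Gr A 1 | L ≤ H} with ht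
  have h1 : ∑ L ∈ t, ∑ S ∈ s with L ≤ S, f S = qNum (Fintype.card F) (k + 1) * ∑ S ∈ s, f S := by
    simp_rw [sum_filter]
    rw [sum_comm, mul_sum]
    refine sum_congr rfl fun S hS => ?_
    rw [hs, mem_filter] at hS
    rw [← sum_filter, sum_const, nsmul_eq_mul, ← card_points hS.1, ht, filter_filter]
    congr 3
    refine filter_congr fun L _ => ?_
    exact ⟨fun h => h.2, fun h => ⟨h.trans hS.2, h⟩⟩
  have h2 : ∑ L ∈ t, (∑ S ∈ s with L ≤ S, f S) ^ 2
      = qNum (Fintype.card F) k * (∑ S ∈ s, f S) ^ 2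
        + (Fintype.card F : ℝ) ^ k * ∑ S ∈ s, f S ^ 2 := by
    rw [sum_sq_sum_filter (r := fun S L => L ≤ S), sq (∑ S ∈ s, f S), sum_mul_sum, mul_sum,
      mul_sum, ← sum_add_distrib]
    refine sum_congr rfl fun S hS => ?_
    have : ∀ S' ∈ s, f S * f S' * (#{L ∈ t | L ≤ S ∧ L ≤ S'} : ℝ)
        = qNum (Fintype.card F) k * (f S * f S')
          + if S = S' then f S * f S' * (Fintype.card F : ℝ) ^ k else 0 := by
      intro S' hS'
      rw [hs, mem_filter] at hS hS'
      rw [ht, card_points_inf hH hS.1 hS'.1 hS.2 hS'.2, mul_add, mul_ite, mul_zero]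
      ring
    rw [sum_congr rfl this, sum_add_distrib, sum_ite_eq, if_pos hS, mul_sum]
    ring
  rw [sum_const, nsmul_eq_mul, card_points hH, ← mul_sum, h1, h2, qNum_succ, qNum_succ]
  ring

theorem missSum_one {A L H : Submodule F V} {k : ℕ} (hL : L ∈ Gr A 1) (hH : H ∈ Gr L (k + 1)) :
    missSum A (k + 1) (fun _ => 1) L H = (Fintype.card F : ℝ) ^ (k + 1) := by
  classical
  rw [missSum_eq_sub]
  have hHA : H ∈ Gr A (k + 1 + 1) := by
    rw [mem_Gr] at *
    exact ⟨hL.1.trans hH.1, by omega⟩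
  have : ({S ∈ {S ∈ Gr A (k + 1) | S ≤ H} | L ≤ S} : Finset _) = {S ∈ Gr L k | S ≤ H} := by
    rw [mem_Gr] at hL
    ext S
    simp only [mem_filter, mem_Gr]
    constructor
    · rintro ⟨⟨⟨h1, h2⟩, h3⟩, h4⟩
      exact ⟨⟨h4, by omega⟩, h3⟩
    · rintro ⟨⟨h1, h2⟩, h3⟩
      exact ⟨⟨⟨hL.1.trans h1, by omega⟩, h3⟩, h1⟩
  rw [this, sum_const, sum_const, nsmul_eq_mul, nsmul_eq_mul, card_hyperplanes _ hHA,
    card_hyperplanes _ hH, qNum_succ _ (k + 1)]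
  ring

theorem complSum_const {A T : Submodule F V} (k m : ℕ) (hV : finrank F A + k + m = finrank F V)
    (hT : T ∈ Gr A m) (c : ℝ) :
    complSum A k (fun _ => c) T = c * (Fintype.card F : ℝ) ^ (k * m) := by
  classical
  suffices h : complSum A k (fun _ => 1) T = (Fintype.card F : ℝ) ^ (k * m) by
    rw [← h, complSum, complSum, mul_sum, mul_one]
  cases k with
  | zero =>
    rw [complSum, Gr_zero, filter_singleton, if_pos (inf_eq_left.mpr (mem_Gr.mp hT).1)]
    simp
  | succ k =>
    induction m generalizing A with
    | zero =>
      rw [Gr_zero, mem_singleton] at hT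
      subst hT
      have : ({S ∈ Gr T (k + 1) | S ⊓ T = T} : Finset _) = {⊤} := by
        ext S
        simp only [mem_filter, mem_Gr, mem_singleton]
        constructor
        · rintro ⟨⟨h1, h2⟩, -⟩
          exact eq_of_le_of_finrank le_top (by rw [finrank_top]; omega)
        · rintro rfl
          exact ⟨⟨le_top, by rw [finrank_top]; omega⟩, top_inf_eq T⟩
      rw [complSum, this]
      simp
    | succ m ih =>
      have hpos : (0 : ℝ) < #{L ∈ Gr A 1 | L ≤ T} := by
        rw [card_points hT]
        exact qNum_succ_pos (by positivity) m
      obtain ⟨L, hLm⟩ := card_pos.mp (Nat.cast_pos.mp hpos)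
      obtain ⟨hL, hLT⟩ := mem_filter.mp hLm
      have hL' := mem_Gr.mp hL
      have hT' := mem_Gr.mp hT
      have h1 := ih (A := L) (mem_Gr.mpr ⟨hLT, by omega⟩) (by omega)
      rw [complSum_eq_complSum_missSum hL hLT, complSum,
        sum_congr rfl fun H hH => missSum_one hL (mem_filter.mp hH).1, mul_add,
        pow_add _ ((k + 1) * m), ← h1, complSum, sum_mul]
      simp

open Classical in
-- Exchanging the sums leaves, for each `S`, the number of its complements, which `complSum_const`
-- gives with the roles of `k` and `m` swapped.
theorem sum_complSum {A : Submodule F V} {k m : ℕ} (hV : finrank F A + k + m = finrank F V)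
    (f : Submodule F V → ℝ) :
    ∑ T ∈ Gr A m, complSum A k f T = (Fintype.card F : ℝ) ^ (k * m) * ∑ S ∈ Gr A k, f S := by
  simp_rw [complSum, sum_filter]
  rw [sum_comm, mul_sum]
  refine sum_congr rfl fun S hS => ?_
  have h := complSum_const m k (by omega) hS (f S)
  rw [complSum, sum_filter] at h
  rw [mul_comm, mul_comm k m, ← h]
  exact sum_congr rfl fun T _ => by rw [inf_comm]

theorem card_Gr_symm {A : Submodule F V} {k m : ℕ} (hV : finrank F A + k + m = finrank F V) :
    (#(Gr A m) : ℝ) = #(Gr A k) := by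
  have h := sum_complSum hV fun _ => 1
  rw [sum_congr rfl fun T hT => complSum_const k m hV hT 1] at h
  have hq : (0 : ℝ) < Fintype.card F := by positivity
  simp only [sum_const, nsmul_eq_mul, one_mul, mul_one] at h
  rw [mul_comm] at h
  exact mul_left_cancel₀ (pow_pos hq _).ne' h

theorem complSum_add_const {A T : Submodule F V} {k m : ℕ}
    (hV : finrank F A + k + m = finrank F V) (hT : T ∈ Gr A m) (f : Submodule F V → ℝ) (c : ℝ) :
    complSum A k (fun S => f S + c) T
      = complSum A k f T + c * (Fintype.card F : ℝ) ^ (k * m) := by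
  rw [← complSum_const k m hV hT c, complSum, sum_add_distrib, complSum, complSum]

theorem card_Gr_pos {A : Submodule F V} {k j : ℕ} (hV : finrank F A + k + j = finrank F V) :
    (0 : ℝ) < #(Gr A k) := by
  rw [card_Gr k hV]
  exact gaussBinom_pos (by positivity) (by omega)

/-- A bound for functions of sum zero implies one for all functions. -/
theorem sum_sq_complSum_le_of_forall {A : Submodule F V} {k m : ℕ} {C : ℝ}
    (hV : finrank F A + k + m = finrank F V)
    (hC : ∀ f : Submodule F V → ℝ, ∑ S ∈ Gr A k, f S = 0 →
      ∑ T ∈ Gr A m, complSum A k f T ^ 2 ≤ C * ∑ S ∈ Gr A k, f S ^ 2)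
    (f : Submodule F V → ℝ) :
    ∑ T ∈ Gr A m, complSum A k f T ^ 2 ≤ C * ∑ S ∈ Gr A k, f S ^ 2
      + (((Fintype.card F : ℝ) ^ (k * m)) ^ 2 - C) * ((∑ S ∈ Gr A k, f S) ^ 2 / #(Gr A k)) := by
  have hG := card_Gr_pos hV
  set G : ℝ := ((#(Gr A k) : ℕ) : ℝ) with hGdef
  set c : ℝ := (∑ S ∈ Gr A k, f S) / G with hc
  have hcG : ∑ S ∈ Gr A k, f S = c * G := by rw [hc, div_mul_cancel₀ _ hG.ne']
  set g : Submodule F V → ℝ := fun S => f S - c with hg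
  have hg0 : ∑ S ∈ Gr A k, g S = 0 := by
    rw [hg, sum_sub_distrib, sum_const, nsmul_eq_mul, hcG]
    ring
  have hfg : f = fun S => g S + c := by
    funext S
    simp [hg]
  have h1 := hC g hg0
  have h2 := sum_complSum hV g
  rw [hg0, mul_zero] at h2
  -- The mean and the mean-zero part have orthogonal images, because `complSum` preserves sum zero.
  have h3 : ∑ T ∈ Gr A m, complSum A k f T ^ 2
      = ∑ T ∈ Gr A m, complSum A k g T ^ 2
        + (c * (Fintype.card F : ℝ) ^ (k * m)) ^ 2 * G := by
    have : ∀ T ∈ Gr A m, complSum A k f T ^ 2 = complSum A k g T ^ 2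
        + 2 * (c * (Fintype.card F : ℝ) ^ (k * m)) * complSum A k g T
        + (c * (Fintype.card F : ℝ) ^ (k * m)) ^ 2 := by
      intro T hT
      rw [hfg, complSum_add_const hV hT]
      ring
    rw [sum_congr rfl this, sum_add_distrib, sum_add_distrib, ← mul_sum, h2, sum_const,
      nsmul_eq_mul, card_Gr_symm hV]
    ring
  have h4 : ∑ S ∈ Gr A k, f S ^ 2 = ∑ S ∈ Gr A k, g S ^ 2 + c ^ 2 * G := by
    have : ∀ S ∈ Gr A k, f S ^ 2 = g S ^ 2 + 2 * c * g S + c ^ 2 := by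
      intro S _
      rw [hfg]
      ring
    rw [sum_congr rfl this, sum_add_distrib, sum_add_distrib, ← mul_sum, hg0, sum_const,
      nsmul_eq_mul]
    ring
  rw [h3, h4, hcG, show (c * G) ^ 2 / G = c ^ 2 * G by field_simp]
  linear_combination h1

end Finite

/-! ### The spectral gap -/

section Finite

variable {F V : Type*} [Field F] [AddCommGroup V] [Module F V] [Finite V]

open Classical in
theorem sum_not_le_eq_neg {A L : Submodule F V} {k : ℕ} {f : Submodule F V → ℝ}
    (hf : ∑ S ∈ Gr A k, f S = 0) :
    ∑ S ∈ Gr A k with ¬ L ≤ S, f S = -∑ S ∈ Gr A k with L ≤ S, f S := by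
  rw [← sum_filter_add_sum_filter_not _ (fun S => L ≤ S)] at hf
  linarith

variable [Fintype F]

open Classical in
theorem sum_sum_sq_missSum {A : Submodule F V} {k m : ℕ}
    (hV : finrank F A + (k + 1) + (m + 1) = finrank F V) (f : Submodule F V → ℝ) :
    ∑ L ∈ Gr A 1, ∑ H ∈ Gr L (k + 1), missSum A (k + 1) f L H ^ 2
      = (Fintype.card F : ℝ) ^ k
          * (qNum (Fintype.card F) (m + 1) * ∑ S ∈ Gr A (k + 1), f S ^ 2)
        + ((Fintype.card F : ℝ) ^ (k + 1) - (Fintype.card F : ℝ) ^ k)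
          * ∑ H ∈ Gr A (k + 2), (∑ S ∈ Gr A (k + 1) with S ≤ H, f S) ^ 2 := by
  rw [← sum_sum_points_le (fun L H => missSum A (k + 1) f L H ^ 2),
    sum_congr rfl fun H hH => sum_sq_missSum hH f, sum_add_distrib, ← mul_sum, ← mul_sum,
    sum_sum_hyperplanes hV]

theorem sum_sq_complSum_le (k m : ℕ) {A : Submodule F V}
    (hV : finrank F A + (k + 1) + m = finrank F V) (f : Submodule F V → ℝ)
    (hf : ∑ S ∈ Gr A (k + 1), f S = 0) :
    ∑ T ∈ Gr A m, complSum A (k + 1) f T ^ 2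
      ≤ ((Fintype.card F : ℝ) ^ ((k + 1) * m)) ^ 2 / (Fintype.card F : ℝ) ^ (k + 1 + m)
        * ∑ S ∈ Gr A (k + 1), f S ^ 2 := by
  classical
  have hq1 := one_lt_card_real F
  induction m generalizing A f with
  | zero =>
    have h : complSum A (k + 1) f A = 0 := by
      rw [complSum, filter_true_of_mem, hf]
      exact fun S hS => inf_eq_right.mpr (mem_Gr.mp hS).1
    rw [Gr_zero, sum_singleton, h, sq, zero_mul]
    positivity
  | succ m ih =>
    have hq : (0 : ℝ) ≤ Fintype.card F := by linarith
    -- Each `T` contains `qNum (m + 1)` points, and all of them give the same value of `complSum`.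
    have hstep : qNum (Fintype.card F) (m + 1) * ∑ T ∈ Gr A (m + 1), complSum A (k + 1) f T ^ 2
        = ∑ L ∈ Gr A 1, ∑ T ∈ Gr L m, complSum L (k + 1) (missSum A (k + 1) f L) T ^ 2 := by
      rw [← sum_sum_points_le
        (fun L T => complSum L (k + 1) (missSum A (k + 1) f L) T ^ 2), mul_sum]
      refine sum_congr rfl fun T hT => ?_
      rw [← card_points hT, ← nsmul_eq_mul, ← sum_const]
      refine sum_congr rfl fun L hL => ?_
      rw [mem_filter] at hL
      rw [complSum_eq_complSum_missSum hL.1 hL.2]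
    set q : ℝ := ((Fintype.card F : ℕ) : ℝ) with hqdef
    set G : ℝ := gaussBinom q (k + 1 + m) (k + 1) with hGdef
    have hG : 0 < G := gaussBinom_pos hq (by omega)
    set C : ℝ := (q ^ ((k + 1) * m)) ^ 2 / q ^ (k + 1 + m) with hCdef
    have hC : 0 ≤ C := by positivity
    -- `missSum` need not have sum zero: its total over base `L` is minus the sum of `f` over the
    -- `S` through `L`, hence the second term.
    have hbound : ∀ L ∈ Gr A 1,
        ∑ T ∈ Gr L m, complSum L (k + 1) (missSum A (k + 1) f L) T ^ 2
          ≤ C * ∑ H ∈ Gr L (k + 1), missSum A (k + 1) f L H ^ 2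
            + ((q ^ ((k + 1) * m)) ^ 2 - C) / G
              * (∑ S ∈ Gr A (k + 1) with L ≤ S, f S) ^ 2 := by
      intro L hL
      have hVL : finrank F L + (k + 1) + m = finrank F V := by
        rw [mem_Gr] at hL
        omega
      refine (sum_sq_complSum_le_of_forall hVL (fun g hg => ih hVL g hg) _).trans (le_of_eq ?_)
      rw [sum_missSum hL, sum_not_le_eq_neg hf, card_Gr (k + 1) hVL, neg_sq]
      ring
    have h1 := hstep.le.trans (sum_le_sum hbound)
    rw [sum_add_distrib, ← mul_sum, ← mul_sum, sum_sum_sq_missSum hV] at h1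
    have hup := sum_sq_up_le (k + 1) hV f hf
    have hpt := sum_sq_points_le k hV f hf
    rw [show k + (m + 1) = k + 1 + m by omega, ← hqdef, ← hGdef] at hpt
    rw [← hqdef] at hup h1
    set E := ∑ L ∈ Gr A 1, (∑ S ∈ Gr A (k + 1) with L ≤ S, f S) ^ 2
    set U := ∑ H ∈ Gr A (k + 2), (∑ S ∈ Gr A (k + 1) with S ≤ H, f S) ^ 2
    set N := ∑ S ∈ Gr A (k + 1), f S ^ 2
    have hCeq : C * q ^ (k + 1 + m) = (q ^ ((k + 1) * m)) ^ 2 := by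
      rw [hCdef, div_mul_cancel₀ _ (by positivity)]
    have h2 : ((q ^ ((k + 1) * m)) ^ 2 - C) / G * E
        ≤ C * ((q ^ (k + 1) - 1) * q ^ k * N) := by
      have e1 : (q ^ ((k + 1) * m)) ^ 2 - C = C * ((q - 1) * qNum q (k + 1 + m)) := by
        rw [sub_one_mul_qNum, ← hCeq]
        ring
      rw [e1, div_mul_eq_mul_div, div_le_iff₀ hG, ← sub_one_mul_qNum]
      have := mul_le_mul_of_nonneg_left hpt (mul_nonneg hC (by linarith : 0 ≤ q - 1))
      linarith
    have h3 : (q ^ (k + 1) - q ^ k) * U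
        ≤ (q ^ (k + 1) - q ^ k) * (q * qNum q (k + 1) * qNum q m * N) := by
      apply mul_le_mul_of_nonneg_left hup
      have := mul_nonneg (pow_nonneg hq k) (by linarith : 0 ≤ q - 1)
      rw [pow_succ]
      linarith
    have h4 := mul_le_mul_of_nonneg_left h3 hC
    apply le_of_mul_le_mul_left _ (qNum_succ_pos hq m)
    -- Raising `m` by one multiplies the target constant by `q ^ (2 * k + 1)`.
    have e2 : (q ^ ((k + 1) * (m + 1))) ^ 2 / q ^ (k + 1 + (m + 1)) = C * q ^ (2 * k + 1) := by
      rw [hCdef]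
      field_simp
      ring
    have e3 := sub_one_mul_qNum q (k + 1)
    rw [e2]
    calc _ ≤ _ := h1
      _ ≤ C * (q ^ k * (qNum q (m + 1) * N)
            + (q ^ (k + 1) - q ^ k) * (q * qNum q (k + 1) * qNum q m * N))
          + C * ((q ^ (k + 1) - 1) * q ^ k * N) := by linarith
      _ = C * (q ^ k * N) * (qNum q (m + 1) + (q - 1) * qNum q (k + 1) * (q * qNum q m)
          + (q ^ (k + 1) - 1)) := by ring
      _ = _ := by
        rw [e3, qNum_succ' q m]
        ring

end Finite

/-! ### Comparing `q ^ (m * k)` with the Gaussian binomial -/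

/-- The extra `x ^ (m + 2)` makes the induction close: multiplying by the next factor leaves the
surplus `x ^ (m + 4) - x ^ (2 * m + 4) ≥ 0`. -/
theorem le_prod_one_sub_pow {x : ℝ} (hx0 : 0 ≤ x) (hx1 : x ≤ 1) (m : ℕ) :
    1 - x - x ^ 2 + x ^ (m + 2) ≤ ∏ i ∈ range (m + 1), (1 - x ^ (i + 1)) := by
  induction m with
  | zero => simp
  | succ m ih =>
    rw [prod_range_succ]
    have h1 : 0 ≤ 1 - x ^ (m + 1 + 1) := sub_nonneg.mpr (pow_le_one₀ hx0 hx1)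
    refine le_trans ?_ (mul_le_mul_of_nonneg_right ih h1)
    have h2 : x ^ (2 * m + 4) ≤ x ^ (m + 4) := pow_le_pow_of_le_one hx0 hx1 (by omega)
    have h3 : (1 - x - x ^ 2 + x ^ (m + 2)) * (1 - x ^ (m + 1 + 1))
        = 1 - x - x ^ 2 + x ^ (m + 1 + 2) + (x ^ (m + 4) - x ^ (2 * m + 4)) := by ring
    linarith

/-- The left side is `q ^ (m * k)` times the product of `1 - q ^ (-(k + i))` for `1 ≤ i ≤ m`, whose
factors are at most one. -/
theorem gaussBinom_mul_prod_le {q : ℝ} (hq : 1 < q) (m k : ℕ) :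
    gaussBinom q (m + k) m * ∏ i ∈ range m, (1 - q⁻¹ ^ (i + 1)) ≤ q ^ (m * k) := by
  have hq0 : 0 < q := by linarith
  induction m generalizing k with
  | zero => simp [gaussBinom]
  | succ m ih =>
    have h1 := ih (k + 1)
    rw [show m + (k + 1) = m + 1 + k by omega] at h1
    have h2 := gaussBinom_succ_mul hq0.le (show m + 1 + k = m + (k + 1) by omega)
    have h3 := sub_one_mul_qNum q (m + 1)
    have h4 := sub_one_mul_qNum q (k + 1)
    rw [prod_range_succ]
    set P := ∏ i ∈ range m, (1 - q⁻¹ ^ (i + 1))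
    have hP : 0 ≤ P := prod_nonneg fun i _ =>
      sub_nonneg.mpr (pow_le_one₀ (by positivity) (inv_le_one_of_one_le₀ hq.le))
    have hg : 0 ≤ gaussBinom q (m + 1 + k) m := (gaussBinom_pos hq0.le (by omega)).le
    have h5 : q ^ (m + 1) * (1 - q⁻¹ ^ (m + 1)) = q ^ (m + 1) - 1 := by
      rw [mul_sub, ← mul_pow, mul_inv_cancel₀ hq0.ne']
      simp
    refine le_of_mul_le_mul_left ?_ (pow_pos hq0 (m + 1))
    calc q ^ (m + 1) * (gaussBinom q (m + 1 + k) (m + 1) * (P * (1 - q⁻¹ ^ (m + 1))))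
        = gaussBinom q (m + 1 + k) (m + 1) * P * (q ^ (m + 1) * (1 - q⁻¹ ^ (m + 1))) := by ring
      _ = (gaussBinom q (m + 1 + k) (m + 1) * qNum q (m + 1)) * P * (q - 1) := by
        rw [h5, ← h3]
        ring
      _ = gaussBinom q (m + 1 + k) m * P * (q ^ (k + 1) - 1) := by
        rw [h2, ← h4]
        ring
      _ ≤ gaussBinom q (m + 1 + k) m * P * q ^ (k + 1) :=
        mul_le_mul_of_nonneg_left (by linarith) (mul_nonneg hg hP)
      _ ≤ q ^ (m * (k + 1)) * q ^ (k + 1) := mul_le_mul_of_nonneg_right h1 (by positivity)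
      _ = _ := by ring

theorem mul_gaussBinom_lt {q : ℝ} (hq : 2 ≤ q) (m k : ℕ) :
    (1 - 3 / 2 * q⁻¹) * gaussBinom q (m + 1 + k) (m + 1) < q ^ ((m + 1) * k) := by
  have hq0 : 0 < q := by linarith
  have hx0 : 0 < q⁻¹ := inv_pos.mpr hq0
  have hx1 : q⁻¹ ≤ 1 / 2 := by
    rw [one_div]
    exact inv_anti₀ (by norm_num) hq
  have h1 := le_prod_one_sub_pow hx0.le (by linarith) m
  have h2 := gaussBinom_mul_prod_le (by linarith : 1 < q) (m + 1) k
  have h3 := pow_pos hx0 (m + 2)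
  have hg : 0 < gaussBinom q (m + 1 + k) (m + 1) := gaussBinom_pos hq0.le (by omega)
  refine lt_of_lt_of_le ?_ h2
  rw [mul_comm]
  refine mul_lt_mul_of_pos_left ?_ hg
  -- `x ≤ 1 / 2` gives `x ^ 2 ≤ x / 2`, whence the `3 / 2`; the positive `x ^ (m + 2)` makes it
  -- strict.
  nlinarith

/-! ### Expander mixing -/

theorem sum_sq_indicator_sub {α : Type*} [DecidableEq α] {X Y : Finset α} (h : Y ⊆ X) (hX : (0 : ℝ) < #X) :
    ∑ x ∈ X, ((if x ∈ Y then 1 else 0) - (#Y : ℝ) / #X) ^ 2 = #Y * (1 - (#Y : ℝ) / #X) := by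
  have h1 : ∑ x ∈ X, (if x ∈ Y then (1 : ℝ) else 0) = #Y := by
    rw [sum_ite_mem, inter_eq_right.mpr h]
    simp
  have h2 : ∀ x ∈ X, ((if x ∈ Y then (1 : ℝ) else 0) - (#Y : ℝ) / #X) ^ 2
      = (1 - 2 * ((#Y : ℝ) / #X)) * (if x ∈ Y then (1 : ℝ) else 0) + ((#Y : ℝ) / #X) ^ 2 := by
    intro x _
    split_ifs <;> ring
  rw [sum_congr rfl h2, sum_add_distrib, ← mul_sum, h1, sum_const, nsmul_eq_mul]
  field_simp
  ring

section Finite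

variable {F V : Type*} [Field F] [AddCommGroup V] [Module F V] [Finite V] [Fintype F]

open Classical in
/-- The expander mixing inequality for complementary pairs of subspaces. -/
theorem sq_card_compl_sub_le {k m : ℕ} (hV : k + 1 + m = finrank F V)
    {Y₁ Y₂ : Finset (Submodule F V)} (h₁ : Y₁ ⊆ Gr ⊥ (k + 1)) (h₂ : Y₂ ⊆ Gr ⊥ m) :
    ((#{p ∈ Y₁ ×ˢ Y₂ | p.1 ⊓ p.2 = ⊥} : ℝ)
        - #Y₁ * #Y₂ * (Fintype.card F : ℝ) ^ ((k + 1) * m) / #(Gr (⊥ : Submodule F V) m)) ^ 2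
      ≤ ((Fintype.card F : ℝ) ^ ((k + 1) * m)) ^ 2 / (Fintype.card F : ℝ) ^ (k + 1 + m)
        * (#Y₁ * (1 - (#Y₁ : ℝ) / #(Gr (⊥ : Submodule F V) m)))
        * (#Y₂ * (1 - (#Y₂ : ℝ) / #(Gr (⊥ : Submodule F V) m))) := by
  have hV' : finrank F (⊥ : Submodule F V) + (k + 1) + m = finrank F V := by
    rw [finrank_bot]
    omega
  have hG := card_Gr_symm hV'
  have hpos := card_Gr_pos hV'
  have hpos' := hpos
  rw [← hG] at hpos'
  have hv₁ := sum_sq_indicator_sub h₁ hpos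
  have hv₂ := sum_sq_indicator_sub h₂ hpos'
  rw [← hG] at hv₁
  set G : ℝ := ((#(Gr (⊥ : Submodule F V) m) : ℕ) : ℝ)
  set f : Submodule F V → ℝ := fun S => (if S ∈ Y₁ then 1 else 0) - #Y₁ / G with hf
  have hsum (X Y : Finset (Submodule F V)) (h : Y ⊆ X) :
      ∑ S ∈ X, (if S ∈ Y then (1 : ℝ) else 0) = #Y := by
    rw [sum_ite_mem, inter_eq_right.mpr h]
    simp
  have hf0 : ∑ S ∈ Gr ⊥ (k + 1), f S = 0 := by
    rw [hf, sum_sub_distrib, hsum _ _ h₁, sum_const, nsmul_eq_mul, ← hG]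
    field_simp
    ring
  have hN := sum_sq_complSum_le k m hV' f hf0
  have hv₁' : ∑ S ∈ Gr ⊥ (k + 1), f S ^ 2 = #Y₁ * (1 - (#Y₁ : ℝ) / G) := hv₁
  rw [hv₁'] at hN
  have hCS := sum_mul_sq_le_sq_mul_sq (Gr ⊥ m)
    (fun T => (if T ∈ Y₂ then (1 : ℝ) else 0) - #Y₂ / G) (complSum ⊥ (k + 1) f)
  rw [hv₂] at hCS
  have hY₂ : (0 : ℝ) ≤ #Y₂ * (1 - #Y₂ / G) := by
    rw [← hv₂]
    exact sum_nonneg fun _ _ => sq_nonneg _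
  have hval : ∀ T ∈ Gr (⊥ : Submodule F V) m, complSum ⊥ (k + 1) f T
      = #{S ∈ Y₁ | S ⊓ T = ⊥} - #Y₁ / G * (Fintype.card F : ℝ) ^ ((k + 1) * m) := by
    intro T hT
    have := complSum_add_const hV' hT (fun S => if S ∈ Y₁ then 1 else 0) (-(#Y₁ / G))
    simp only [← sub_eq_add_neg] at this
    rw [hf, this, complSum, sum_ite_mem, sum_const, nsmul_eq_mul, mul_one, neg_mul,
      ← sub_eq_add_neg]
    congr 3
    ext S
    simp only [mem_inter, mem_filter]
    exact ⟨fun h => ⟨h.2, h.1.2⟩, fun h => ⟨⟨h₁ h.1, h.2⟩, h.1⟩⟩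
  -- Centring the indicator of `Y₂` changes nothing in this sum, since `complSum` of `f` has total
  -- zero.
  have hlhs : ∑ T ∈ Gr ⊥ m, ((if T ∈ Y₂ then (1 : ℝ) else 0) - #Y₂ / G)
        * complSum ⊥ (k + 1) f T
      = (#{p ∈ Y₁ ×ˢ Y₂ | p.1 ⊓ p.2 = ⊥} : ℝ)
        - #Y₁ * #Y₂ * (Fintype.card F : ℝ) ^ ((k + 1) * m) / G := by
    simp_rw [sub_mul, sum_sub_distrib]
    rw [← mul_sum, sum_complSum hV', hf0, mul_zero, mul_zero, sub_zero]
    simp_rw [ite_mul, zero_mul, one_mul]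
    rw [sum_ite_mem, inter_eq_right.mpr h₂, sum_congr rfl fun T hT => hval T (h₂ hT),
      sum_sub_distrib, sum_const, nsmul_eq_mul, card_filter, sum_product_right]
    simp_rw [card_filter]
    push_cast
    ring
  rw [hlhs] at hCS
  refine hCS.trans ?_
  rw [mul_comm]
  exact mul_le_mul_of_nonneg_right hN hY₂

end Finite

theorem coe_Gr_bot {F V : Type*} [Field F] [AddCommGroup V] [Module F V]
    [Finite V] (e : ℕ) :
    (Gr (⊥ : Submodule F V) e : Set (Submodule F V))
      = subspacesOfDim F V e := by
  ext S
  rw [Finset.mem_coe, mem_Gr]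
  simp [subspacesOfDim]

/-- This bounds the variance of an indicator by a multiple of `y ^ 2 / G`, so that the square root
in the mixing inequality becomes proportional to `y₁ * y₂`. -/
theorem mul_one_sub_div_le {G y α : ℝ} (hy : 0 ≤ y) (hα : 0 < α)
    (h : α ≤ y / G) : y * (1 - y / G) ≤ y * (y / G) * (1 / α - 1) := by
  have h1 : 1 ≤ y / G * (1 / α) := by
    rw [mul_one_div, le_div_iff₀ hα, one_mul]
    exact h
  have := mul_le_mul_of_nonneg_left h1 hy
  linarith

end ComplementaryPairs

/-! ### The main theorem -/

theorem mainTheorem4 {F V : Type*} [Field F] [Fintype F] [AddCommGroup V] [Module F V]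
    (q e₁ e₂ d : ℕ) (hq : Fintype.card F = q) (he₂ : 1 ≤ e₂) (he₁ : e₂ ≤ e₁)
    (hd : d = e₁ + e₂) (hV : Module.finrank F V = d)
    (Y₁ Y₂ : Set (Submodule F V))
    (hY₁ : Y₁ ⊆ ComplementaryPairs.subspacesOfDim F V e₁)
    (hY₂ : Y₂ ⊆ ComplementaryPairs.subspacesOfDim F V e₂)
    (hne₁ : Y₁.Nonempty) (hne₂ : Y₂.Nonempty)
    (α : ℝ) (hα : 0 < α)
    (hαmin : α ≤ min (ComplementaryPairs.density e₁ Y₁) (ComplementaryPairs.density e₂ Y₂)) :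
    (1 - 3 / 2 * (q : ℝ)⁻¹) * (1 - (1 / α - 1) * (q : ℝ) ^ (-(d : ℝ) / 2)) ≤
        ComplementaryPairs.complementaryProportion Y₁ Y₂ ∧
      ((1 / α - 1) * (q : ℝ) ^ (-(d : ℝ) / 2) ≠ 1 →
        (1 - 3 / 2 * (q : ℝ)⁻¹) * (1 - (1 / α - 1) * (q : ℝ) ^ (-(d : ℝ) / 2)) <
          ComplementaryPairs.complementaryProportion Y₁ Y₂) := by
  classical
  have : FiniteDimensional F V := Module.finite_of_finrank_pos (by omega)
  have : Finite V := Module.finite_of_finite F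
  obtain ⟨k, rfl⟩ : ∃ k, e₁ = k + 1 := ⟨e₁ - 1, by omega⟩
  obtain ⟨m, rfl⟩ : ∃ m, e₂ = m + 1 := ⟨e₂ - 1, by omega⟩
  obtain ⟨Z₁, rfl⟩ := (Set.toFinite Y₁).exists_finset_coe
  obtain ⟨Z₂, rfl⟩ := (Set.toFinite Y₂).exists_finset_coe
  rw [← ComplementaryPairs.coe_Gr_bot, Finset.coe_subset] at hY₁ hY₂
  rw [Finset.coe_nonempty] at hne₁ hne₂
  have hprop : ComplementaryPairs.complementaryProportion
        (Z₁ : Set (Submodule F V)) (Z₂ : Set (Submodule F V))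
      = ((Z₁ ×ˢ Z₂).filter fun p => p.1 ⊓ p.2 = ⊥).card / ((Z₁.card : ℝ) * Z₂.card) := by
    have : {p : Submodule F V × Submodule F V | p.1 ∈ (Z₁ : Set (Submodule F V)) ∧
          p.2 ∈ (Z₂ : Set (Submodule F V)) ∧ p.1 ⊓ p.2 = ⊥}
        = ((Z₁ ×ˢ Z₂).filter fun p => p.1 ⊓ p.2 = ⊥ : Finset _) := by
      ext p
      simp [and_assoc]
    rw [ComplementaryPairs.complementaryProportion, this, Set.ncard_coe_finset,
      Set.ncard_coe_finset, Set.ncard_coe_finset]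
  have hdim : Module.finrank F (⊥ : Submodule F V) + (k + 1) + (m + 1) = Module.finrank F V := by
    rw [finrank_bot]
    omega
  have hGsymm := ComplementaryPairs.card_Gr_symm hdim
  have hGpos := ComplementaryPairs.card_Gr_pos hdim
  have hmix := ComplementaryPairs.sq_card_compl_sub_le (by omega) hY₁ hY₂
  have hGcard := ComplementaryPairs.card_Gr (A := (⊥ : Submodule F V)) (m + 1) (j := k + 1)
    (by omega)
  rw [hprop]
  rw [ComplementaryPairs.density, ComplementaryPairs.density, ← ComplementaryPairs.coe_Gr_bot,
    ← ComplementaryPairs.coe_Gr_bot] at hαmin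
  simp only [Set.ncard_coe_finset] at hαmin
  rw [← hGsymm] at hαmin hGpos
  set e : ℝ := ((((Z₁ ×ˢ Z₂).filter fun p => p.1 ⊓ p.2 = ⊥).card : ℕ) : ℝ)
  set G : ℝ := (((ComplementaryPairs.Gr (⊥ : Submodule F V) (m + 1)).card : ℕ) : ℝ)
  have hy₁ : (0 : ℝ) < Z₁.card := by exact_mod_cast hne₁.card_pos
  have hy₂ : (0 : ℝ) < Z₂.card := by exact_mod_cast hne₂.card_pos
  have hle₂ : (Z₂.card : ℝ) ≤ G := Nat.cast_le.mpr (Finset.card_le_card hY₂)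
  obtain ⟨hα₁, hα₂⟩ := le_min_iff.mp hαmin
  have hq2 : (2 : ℝ) ≤ q := by
    rw [← hq]
    exact_mod_cast Fintype.one_lt_card
  rw [hq] at hmix hGcard
  have hlt := ComplementaryPairs.mul_gaussBinom_lt hq2 m (k + 1)
  rw [← hGcard, mul_comm (m + 1)] at hlt
  have he : 0 ≤ e := Nat.cast_nonneg _
  set y₁ : ℝ := ((Z₁.card : ℕ) : ℝ)
  set y₂ : ℝ := ((Z₂.card : ℕ) : ℝ)
  have hq0 : (0 : ℝ) < q := by linarith
  set Q : ℝ := (q : ℝ) ^ ((k + 1) * (m + 1)) with hQ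
  have hQ0 : 0 < Q := by positivity
  set t : ℝ := (q : ℝ) ^ (-(d : ℝ) / 2) with ht
  have ht0 : 0 < t := Real.rpow_pos_of_pos hq0 _
  have ht2 : t ^ 2 = 1 / (q : ℝ) ^ (k + 1 + (m + 1)) := by
    rw [← hd, ht, ← Real.rpow_natCast, ← Real.rpow_mul hq0.le, one_div,
      ← Real.rpow_natCast (q : ℝ) d, ← Real.rpow_neg hq0.le]
    congr 1
    push_cast
    ring
  set β : ℝ := 1 / α - 1
  have hβ : 0 ≤ β := by
    have h1 : α ≤ 1 := hα₂.trans ((div_le_one hGpos).mpr hle₂)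
    have := (one_le_div hα).mpr h1
    linarith
  set c : ℝ := 1 - 3 / 2 * (q : ℝ)⁻¹
  have hc : 0 < c := by
    have : (q : ℝ)⁻¹ ≤ 2⁻¹ := inv_anti₀ (by norm_num) hq2
    simp only [c]
    linarith
  have hcQ : c < Q / G := by rwa [lt_div_iff₀ hGpos]
  have hP : Q / G * (1 - β * t) ≤ e / (y₁ * y₂) := by
    have hd₁ := ComplementaryPairs.mul_one_sub_div_le hy₁.le hα hα₁
    have hd₂ := ComplementaryPairs.mul_one_sub_div_le hy₂.le hα hα₂
    have hpos₂ : 0 ≤ y₂ * (1 - y₂ / G) :=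
      mul_nonneg hy₂.le (sub_nonneg.mpr ((div_le_one hGpos).mpr hle₂))
    have h1 : (e - y₁ * y₂ * Q / G) ^ 2 ≤ (y₁ * y₂ * Q / G * (β * t)) ^ 2 := by
      refine hmix.trans ?_
      rw [← mul_one_div (Q ^ 2), ← ht2, mul_assoc]
      calc _ ≤ Q ^ 2 * t ^ 2 * ((y₁ * (y₁ / G) * β) * (y₂ * (y₂ / G) * β)) := by
            gcongr
        _ = _ := by ring
    have h2 := (abs_le_of_sq_le_sq' h1 (by positivity)).1
    rw [le_div_iff₀ (by positivity)]
    calc _ = y₁ * y₂ * Q / G - y₁ * y₂ * Q / G * (β * t) := by ring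
      _ ≤ _ := by linarith
  have hstrict : β * t ≠ 1 → c * (1 - β * t) < e / (y₁ * y₂) := by
    intro hne
    rcases lt_or_gt_of_ne hne with h | h
    -- Strictness comes from `c < Q / G` when `1 - β * t` is positive; when it is negative, the
    -- bound lies below zero.
    · exact (mul_lt_mul_of_pos_right hcQ (by linarith)).trans_le hP
    · exact (mul_neg_of_pos_of_neg hc (by linarith)).trans_le (by positivity)
  refine ⟨?_, hstrict⟩
  by_cases h : β * t = 1
  · rw [h, sub_self, mul_zero]
    positivity
  · exact (hstrict h).le
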